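/- For integers $n\ge 1$ and $k$ (possibly negative) let $T_n(k)=\sum_{i\text{ odd}}\binom{n}{i}i^k\in\mathbf{Q}$, where the sum is over odd $i$ with $1\le i\le n$. Let $\nu$ denote the 2-adic valuation (exponent of $2$) on $\mathbf{Q}_2$, with $\nu(0)=\infty$. Let $n\ge5$ be an integer that is not of the form $2^m-1$, let $e$ be the integer with $2^e\le n\le 2^{e+1}-2$, and let $$(a,b)=\begin{cases}(-2,1)&\text{if }n=2^{e},\\(-1,2)&\text{if }2^{e}<n\le 3\cdot2^{e-1},\\(0,1)&\text{if }3\cdot2^{e-1}<n\le2^{e+1}-2.\end{cases}$$ Then there exists a 2-adic integer $\bar x_n$ such that for all integers $x$ $$\nu\bigl(T_n(2^{e+a}x)\bigr)=\nu(x-\bar x_n)+n-b.$$ -/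

import Mathlib

/-- The partial Stirling number `T_n(k) = ∑_{i odd} (n choose i) i^k`. The exponent `k` is any
integer, so that the value is a rational number; only odd (hence nonzero) `i` are raised to the
power `k`. The terms with `i > n` vanish. -/
def partialStirling (n : ℕ) (k : ℤ) : ℚ :=
  ∑ i ∈ (Finset.range (n + 1)).filter (fun i => Odd i), (n.choose i : ℚ) * (i : ℚ) ^ k

/-- The exponent of `2` in a 2-adic number, with `ν(0) = ∞`. -/
noncomputable def nu (z : ℚ_[2]) : WithTop ℤ := Padic.addValuation z

/-! Write `n + 1` for the integer of the theorem. Expanding `(2i+1)^k` in powers of `2i`, then `i^j`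
in the binomials `C(i,p)`, and summing over `i` in closed form gives, for natural `k`, T_{n+1}(k) =
2^n ∑_{j,p} W(p) 2^(j-p) S(j,p) C(k,j) with W(p) = p! C(n-p,p) / 2^p.

Take `k` and `d` divisible by `2^c`. In T_{n+1}(k+d) - T_{n+1}(k), expanded by Vandermonde, the term
W(p₀) C(d,p₀) alone has least valuation; so the difference has valuation exactly n + ν(d) - E
(`IsDominantIndex.exact_add_sub`). Here p₀ is the unique place where ν(W(p)) - ν(p) attains its
minimum -E: it is 2^c when the integer of the theorem is 2^e, and 2^e - 2^i otherwise.

Hence x ↦ T_{n+1}(2^c x) / 2^(n+c-E) preserves 2-adic distances. Negative exponents are reached by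
2-adic continuity in `k`. The value at 0 is integral, and an integral isometry has a 2-adic zero,
since over the residue field with two elements each binary digit can be corrected in turn
(`exists_zero_of_isometry`). The distance to that zero is the size of the value. -/

/-! ### Newton expansion of the partial Stirling numbers. -/

theorem sum_choose_odd_mul_add_two (n N : ℕ) (hN : n + 2 < N) (φ : ℕ → ℚ) :
    ∑ i ∈ Finset.range N, ((n + 2).choose (2 * i + 1) : ℚ) * φ i =
      2 * ∑ i ∈ Finset.range N, ((n + 1).choose (2 * i + 1) : ℚ) * φ i
        + ∑ i ∈ Finset.range N, (n.choose (2 * i + 1) : ℚ) * (φ (i + 1) - φ i) := by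
  obtain ⟨M, rfl⟩ : ∃ M, N = M + 1 := ⟨N - 1, by omega⟩
  have hshift : ∑ i ∈ Finset.range (M + 1), (n.choose (2 * i + 1) : ℚ) * φ (i + 1) =
      ∑ i ∈ Finset.range M, (n.choose (2 * i + 1) : ℚ) * φ (i + 1) := by
    rw [Finset.sum_range_succ, Nat.choose_eq_zero_of_lt (by omega)]
    simp
  simp_rw [mul_sub, Finset.sum_sub_distrib]
  rw [hshift]
  simp_rw [Finset.sum_range_succ']
  have h0 : ((n + 2).choose (2 * 0 + 1) : ℚ) = 2 * ((n + 1).choose (2 * 0 + 1) : ℚ)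
      - (n.choose (2 * 0 + 1) : ℚ) := by
    simp; ring
  have h1 : ∀ i, ((n + 2).choose (2 * (i + 1) + 1) : ℚ) =
      2 * ((n + 1).choose (2 * (i + 1) + 1) : ℚ) - (n.choose (2 * (i + 1) + 1) : ℚ)
        + (n.choose (2 * i + 1) : ℚ) := by
    intro i
    have e : 2 * (i + 1) + 1 = (2 * i + 1) + 1 + 1 := by ring
    rw [e, Nat.choose_succ_succ (n + 1) (2 * i + 1 + 1), Nat.choose_succ_succ n (2 * i + 1 + 1),
      Nat.choose_succ_succ n (2 * i + 1)]
    push_cast; ring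
  rw [h0]
  simp_rw [h1, add_mul, sub_mul, Finset.sum_add_distrib, Finset.sum_sub_distrib, mul_assoc,
    ← Finset.mul_sum]
  ring

/-- The forward difference of `C(i,p+1)` in `i` is `C(i,p)`, so the preceding recurrence lowers `n`
and `p` together and becomes Pascal's rule for the right-hand side. -/
theorem sum_choose_odd_mul_choose (n p N : ℕ) (hN : n + 1 < N) :
    ∑ i ∈ Finset.range N, ((n + 1).choose (2 * i + 1) : ℚ) * (i.choose p : ℚ) =
      if 2 * p ≤ n then (2 : ℚ) ^ n / 4 ^ p * ((n - p).choose p : ℚ) else 0 := by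
  induction n using Nat.strong_induction_on generalizing p with
  | _ n ih =>
    match n, ih with
    | 0, _ =>
      rw [Finset.sum_eq_single 0]
      · rcases p with _ | p <;> simp
      · intro i _ hi
        rw [Nat.choose_eq_zero_of_lt (by omega)]; simp
      · simp; omega
    | 1, _ =>
      rw [Finset.sum_eq_single 0]
      · rcases p with _ | p
        · simp
        · simp
      · intro i _ hi
        rw [Nat.choose_eq_zero_of_lt (by omega)]; simp
      · simp; omega
    | n + 2, ih =>
      rw [sum_choose_odd_mul_add_two (n + 1) N (by omega)]
      rw [ih (n + 1) (by omega) _ (by omega)]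
      rcases p with _ | p
      · simp; ring
      · have : ∀ i : ℕ, ((i + 1).choose (p + 1) : ℚ) - (i.choose (p + 1) : ℚ) = i.choose p := by
          intro i; rw [Nat.choose_succ_succ]; push_cast; ring
        simp_rw [this]
        rw [ih n (by omega) _ (by omega)]
        by_cases h1 : 2 * (p + 1) ≤ n + 1
        · rw [if_pos h1, if_pos (by omega), if_pos (by omega)]
          have e1 : n + 2 - (p + 1) = (n - p) + 1 := by omega
          have e2 : n + 1 - (p + 1) = n - p := by omega
          rw [e1, e2, Nat.choose_succ_succ]
          push_cast
          field_simp
          ring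
        · by_cases h2 : 2 * p ≤ n
          · have : n = 2 * p := by omega
            subst this
            rw [if_neg h1, if_pos (by omega), if_pos (by omega)]
            have e1 : 2 * p + 2 - (p + 1) = p + 1 := by omega
            have e2 : 2 * p - p = p := by omega
            rw [e1, e2]
            simp
            field_simp
            ring
          · rw [if_neg h1, if_neg h2, if_neg (by omega)]; simp

theorem pow_eq_sum_stirlingSecond_mul_choose (i j N : ℕ) (hN : j < N) :
    (i : ℚ) ^ j = ∑ p ∈ Finset.range N,
      (Nat.stirlingSecond j p : ℚ) * (p.factorial : ℚ) * (i.choose p : ℚ) := by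
  induction j generalizing N with
  | zero =>
    rw [Finset.sum_eq_single 0]
    · simp
    · intro p _ hp
      obtain ⟨q, rfl⟩ := Nat.exists_eq_succ_of_ne_zero hp
      simp [Nat.stirlingSecond_zero_succ]
    · simp; omega
  | succ j ih =>
    obtain ⟨M, rfl⟩ : ∃ M, N = M + 1 := ⟨N - 1, by omega⟩
    rw [Finset.sum_range_succ', Nat.stirlingSecond_succ_zero]
    have key : ∀ p : ℕ, (i : ℚ) * (i.choose p : ℚ) =
        p * (i.choose p : ℚ) + (p + 1) * (i.choose (p + 1) : ℚ) := by
      intro p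
      have h := Nat.choose_succ_right_eq i p
      rcases le_total p i with hp | hp
      · have h' : ((i.choose (p + 1) : ℕ) : ℚ) * (p + 1) = i.choose p * (i - p) := by
          rw [← Nat.cast_sub hp]; exact_mod_cast h
        linarith
      · rcases eq_or_lt_of_le hp with rfl | hp
        · simp
        · rw [Nat.choose_eq_zero_of_lt hp, Nat.choose_eq_zero_of_lt (by omega)]; simp
    have hS : ∀ p, (Nat.stirlingSecond (j + 1) (p + 1) : ℚ) =
        (p + 1) * Nat.stirlingSecond j (p + 1) + Nat.stirlingSecond j p := by
      intro p; rw [Nat.stirlingSecond_succ_succ]; push_cast; ring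
    have hsum : ∑ p ∈ Finset.range M, (p + 1 : ℚ) * ((Nat.stirlingSecond j (p + 1) : ℚ)
          * ((p + 1).factorial : ℚ) * (i.choose (p + 1) : ℚ)) =
        ∑ p ∈ Finset.range M, (p : ℚ) * ((Nat.stirlingSecond j p : ℚ)
          * (p.factorial : ℚ) * (i.choose p : ℚ)) := by
      have h1 := Finset.sum_range_succ (fun p : ℕ => (p : ℚ) * ((Nat.stirlingSecond j p : ℚ)
          * (p.factorial : ℚ) * (i.choose p : ℚ))) M
      have h2 := Finset.sum_range_succ' (fun p : ℕ => (p : ℚ) * ((Nat.stirlingSecond j p : ℚ)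
          * (p.factorial : ℚ) * (i.choose p : ℚ))) M
      rw [Nat.stirlingSecond_eq_zero_of_lt (by omega : j < M)] at h1
      rw [h1] at h2
      push_cast at h2 ⊢
      linarith
    rw [pow_succ, ih M (by omega), Finset.sum_mul]
    simp only [Nat.cast_zero, zero_mul, add_zero]
    have hL : ∀ p ∈ Finset.range M, (Nat.stirlingSecond j p : ℚ) * (p.factorial : ℚ)
        * (i.choose p : ℚ) * i = (p : ℚ) * ((Nat.stirlingSecond j p : ℚ)
          * (p.factorial : ℚ) * (i.choose p : ℚ)) + (Nat.stirlingSecond j p : ℚ)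
          * ((p + 1).factorial : ℚ) * (i.choose (p + 1) : ℚ) := by
      intro p _
      rw [mul_assoc _ _ (i : ℚ), mul_comm _ (i : ℚ), key, Nat.factorial_succ]
      push_cast; ring
    rw [Finset.sum_congr rfl hL, Finset.sum_add_distrib, ← hsum, ← Finset.sum_add_distrib]
    refine Finset.sum_congr rfl fun p _ => ?_
    rw [hS]; ring

theorem partialStirling_eq_sum_range (n N : ℕ) (k : ℤ) (hN : n < N) :
    partialStirling n k =
      ∑ i ∈ Finset.range N, (n.choose (2 * i + 1) : ℚ) * ((2 * i + 1 : ℕ) : ℚ) ^ k := by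
  unfold partialStirling
  have hsub : (Finset.range (n + 1)).filter (fun i => Odd i) ⊆
      (Finset.range N).image (fun i => 2 * i + 1) := by
    intro i hi
    simp only [Finset.mem_filter, Finset.mem_range, Finset.mem_image] at hi ⊢
    obtain ⟨h, m, rfl⟩ := hi
    exact ⟨m, by omega, rfl⟩
  rw [Finset.sum_subset hsub, Finset.sum_image]
  · intro a _ b _ h
    simpa using h
  · intro i hi hi'
    simp only [Finset.mem_filter, Finset.mem_range, Finset.mem_image, not_and] at hi hi'
    obtain ⟨m, hm, rfl⟩ := hi
    rw [Nat.choose_eq_zero_of_lt]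
    · simp
    · by_contra hlt
      exact hi' (by omega) ⟨m, rfl⟩

/-- The coefficient of `2 ^ (j - p) * S(j, p) * (k choose j)` in `T_{n+1}(k) / 2 ^ n`. -/
def newtonWeight (n p : ℕ) : ℚ :=
  if 2 * p ≤ n then (p.factorial : ℚ) * ((n - p).choose p : ℚ) / 2 ^ p else 0

theorem partialStirling_natCast (n k J : ℕ) (hJ : k < J) :
    partialStirling (n + 1) (k : ℤ) = 2 ^ n * ∑ j ∈ Finset.range J, ∑ p ∈ Finset.range (j + 1),
      newtonWeight n p * (2 ^ (j - p) * Nat.stirlingSecond j p : ℕ) * (k.choose j : ℚ) := by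
  rw [partialStirling_eq_sum_range (n + 1) (n + 2) k (by omega)]
  have hexp : ∀ i : ℕ, ((2 * i + 1 : ℕ) : ℚ) ^ (k : ℤ) =
      ∑ j ∈ Finset.range J, ∑ p ∈ Finset.range (j + 1), (k.choose j : ℚ) * 2 ^ j *
        ((Nat.stirlingSecond j p : ℚ) * (p.factorial : ℚ)) * (i.choose p : ℚ) := by
    intro i
    rw [zpow_natCast]
    push_cast
    rw [add_pow]
    rw [Finset.sum_subset (Finset.range_mono (by omega : k + 1 ≤ J))]
    · refine Finset.sum_congr rfl fun j _ => ?_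
      rw [mul_pow, pow_eq_sum_stirlingSecond_mul_choose i j (j + 1) (by omega), one_pow,
        Finset.mul_sum, Finset.sum_mul, Finset.sum_mul]
      exact Finset.sum_congr rfl fun p _ => by ring
    · intro j _ hj
      simp only [Finset.mem_range, not_lt] at hj
      rw [Nat.choose_eq_zero_of_lt (by omega)]; simp
  simp_rw [hexp, Finset.mul_sum]
  rw [Finset.sum_comm]
  refine Finset.sum_congr rfl fun j _ => ?_
  rw [Finset.sum_comm]
  refine Finset.sum_congr rfl fun p hp => ?_
  have h := sum_choose_odd_mul_choose n p (n + 2) (by omega)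
  calc _ = (k.choose j : ℚ) * 2 ^ j * ((Nat.stirlingSecond j p : ℚ) * (p.factorial : ℚ)) *
        ∑ i ∈ Finset.range (n + 2), ((n + 1).choose (2 * i + 1) : ℚ) * (i.choose p : ℚ) := by
          rw [Finset.mul_sum]
          exact Finset.sum_congr rfl fun i _ => by ring
    _ = _ := by
      rw [h, newtonWeight]
      split_ifs
      · have hp' : p ≤ j := by simp at hp; omega
        obtain ⟨m, rfl⟩ := Nat.exists_eq_add_of_le hp'
        simp only [Nat.add_sub_cancel_left]
        push_cast
        have : (4 : ℚ) ^ p = 2 ^ p * 2 ^ p := by rw [← mul_pow]; norm_num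
        rw [this, pow_add]
        field_simp
      · simp

theorem choose_add_sub_choose (k d j : ℕ) :
    ((k + d).choose j : ℚ) - (k.choose j : ℚ) =
      ∑ l ∈ Finset.range j, (d.choose (l + 1) : ℚ) * (k.choose (j - (l + 1)) : ℚ) := by
  rw [add_comm k d, Nat.add_choose_eq, Finset.Nat.sum_antidiagonal_eq_sum_range_succ
    (fun a b => d.choose a * k.choose b), Finset.sum_range_succ']
  push_cast
  simp

theorem partialStirling_add_sub (n k d : ℕ) :
    partialStirling (n + 1) ((k + d : ℕ) : ℤ) - partialStirling (n + 1) (k : ℤ) =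
      2 ^ n * ∑ j ∈ Finset.range (k + d + 1), ∑ p ∈ Finset.range (j + 1), ∑ l ∈ Finset.range j,
        newtonWeight n p * (2 ^ (j - p) * Nat.stirlingSecond j p : ℕ) *
          ((d.choose (l + 1) : ℚ) * (k.choose (j - (l + 1)) : ℚ)) := by
  rw [partialStirling_natCast n (k + d) (k + d + 1) (by omega),
    partialStirling_natCast n k (k + d + 1) (by omega), ← mul_sub, ← Finset.sum_sub_distrib]
  congr 1
  refine Finset.sum_congr rfl fun j _ => ?_
  rw [← Finset.sum_sub_distrib]
  refine Finset.sum_congr rfl fun p _ => ?_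
  rw [← mul_sub, choose_add_sub_choose, Finset.mul_sum]

/-! ### Powers of 2 in Stirling numbers and binomial coefficients. -/

/-- The coefficients expressing `S(p + m, p)` as a combination of the `p + m choose m + r`
(associated Stirling numbers of the second kind). -/
def assocStirling : ℕ → ℕ → ℕ
  | 0, 0 => 1
  | 0, _ + 1 => 0
  | _ + 1, 0 => 0
  | m + 1, r + 1 => (r + 1) * assocStirling m (r + 1) + (m + r + 1) * assocStirling m r

theorem assocStirling_eq_zero_of_lt (m r : ℕ) (h : m < r) : assocStirling m r = 0 := by
  induction m generalizing r with
  | zero =>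
    obtain ⟨s, rfl⟩ := Nat.exists_eq_succ_of_ne_zero (by omega : r ≠ 0)
    rfl
  | succ m ih =>
    obtain ⟨s, rfl⟩ := Nat.exists_eq_succ_of_ne_zero (by omega : r ≠ 0)
    rw [Nat.succ_eq_add_one, assocStirling, ih _ (by omega), ih _ (by omega)]
    simp

/-- For m > 0 all lower indices m + r lie between 1 and 2m, so each binomial coefficient inherits
most of the power of 2 dividing p + m. -/
theorem stirlingSecond_add_left (m p : ℕ) : Nat.stirlingSecond (p + m) p =
    ∑ r ∈ Finset.range (m + 1), (p + m).choose (m + r) * assocStirling m r := by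
  induction m generalizing p with
  | zero => simp [Nat.stirlingSecond_self, assocStirling]
  | succ m ihm =>
    induction p with
    | zero =>
      rw [Finset.sum_range_succ', zero_add, Nat.stirlingSecond_succ_zero,
        Finset.sum_eq_zero]
      · simp [assocStirling]
      · intro r _
        rw [Nat.choose_eq_zero_of_lt (by omega), zero_mul]
    | succ p ihp =>
      have e : p + 1 + (m + 1) = (p + m + 1) + 1 := by ring
      rw [e, Nat.stirlingSecond_succ_succ]
      have h1 := ihm (p + 1)
      rw [show p + 1 + m = p + m + 1 by ring] at h1
      rw [show p + (m + 1) = p + m + 1 by ring] at ihp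
      rw [h1, ihp]
      have hP : ∀ r, (p + m + 1 + 1).choose (m + 1 + r) =
          (p + m + 1).choose (m + r) + (p + m + 1).choose (m + 1 + r) := by
        intro r
        rw [show m + 1 + r = (m + r) + 1 by ring, Nat.choose_succ_succ]
      simp_rw [hP, add_mul, Finset.sum_add_distrib]
      refine congrArg₂ (· + ·) ?_ rfl
      rw [Finset.sum_range_succ'
        (fun r => (p + m + 1).choose (m + r) * assocStirling (m + 1) r) (m + 1)]
      simp only [assocStirling, mul_add, Finset.sum_add_distrib, mul_zero, add_zero]
      have h2 : ∑ r ∈ Finset.range (m + 1), (p + m + 1).choose (m + (r + 1)) *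
          ((r + 1) * assocStirling m (r + 1)) =
          ∑ r ∈ Finset.range (m + 1), r * ((p + m + 1).choose (m + r) * assocStirling m r) := by
        have a1 := Finset.sum_range_succ
          (fun r => r * ((p + m + 1).choose (m + r) * assocStirling m r)) (m + 1)
        have a2 := Finset.sum_range_succ'
          (fun r => r * ((p + m + 1).choose (m + r) * assocStirling m r)) (m + 1)
        rw [assocStirling_eq_zero_of_lt m (m + 1) (by omega)] at a1
        simp only [mul_zero, add_zero, zero_mul] at a1 a2
        rw [← a1, a2]
        exact Finset.sum_congr rfl fun r _ => by ring
      rw [h2, ← Finset.sum_add_distrib, ← add_mul, Finset.mul_sum]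
      refine Finset.sum_congr rfl fun r _ => ?_
      have h3 := Nat.choose_succ_right_eq (p + m + 1) (m + r)
      rcases le_or_gt (m + r) (p + m + 1) with hr | hr
      · obtain ⟨q, hq⟩ := Nat.exists_eq_add_of_le hr
        rw [hq] at h3 ⊢
        rw [Nat.add_sub_cancel_left] at h3
        have hpq : p + 1 = r + q := by omega
        rw [hpq, ← add_assoc m r 1]
        linear_combination assocStirling m r * h3.symm
      · rw [Nat.choose_eq_zero_of_lt hr, Nat.choose_eq_zero_of_lt (by omega)]; simp

/-- With t = ν(q), the identity q C(j,q) = j C(j-1,q-1) costs at most t factors of 2. Since 2^t ≤ 2m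
< 2^(m-g+1), t ≤ m - g, so 2^m repays the loss with g factors to spare. -/
theorem two_pow_dvd_two_pow_mul_choose {j q v m g : ℕ} (hv : 2 ^ v ∣ j) (hq : q ≠ 0)
    (hqm : q ≤ 2 * m) (hg : g ≤ m) (hm : m < 2 ^ (m - g)) :
    2 ^ (v + g) ∣ 2 ^ m * j.choose q := by
  obtain ⟨t, u, hu, rfl⟩ := Nat.exists_eq_two_pow_mul_odd hq
  have hdvd : 2 ^ v ∣ (2 ^ t * u) * j.choose (2 ^ t * u) := by
    rcases j with _ | j
    · rw [Nat.choose_eq_zero_of_lt (Nat.pos_of_ne_zero hq)]; simp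
    · obtain ⟨q', hq'⟩ := Nat.exists_eq_succ_of_ne_zero hq
      rw [hq', mul_comm, ← Nat.add_one_mul_choose_eq]
      exact hv.mul_right _
  have hcop : Nat.Coprime (2 ^ v) u := (Nat.coprime_two_left.2 hu).pow_left v
  have h2 : 2 ^ v ∣ 2 ^ t * j.choose (2 ^ t * u) := by
    refine hcop.dvd_of_dvd_mul_left ?_
    convert hdvd using 1; ring
  have ht : t + g ≤ m := by
    have hu1 : 1 ≤ u := hu.pos
    have h3 : 2 ^ t < 2 ^ (m - g + 1) := by
      rw [pow_succ]; nlinarith [Nat.one_le_two_pow (n := t)]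
    have := (Nat.pow_lt_pow_iff_right (by norm_num : 1 < 2)).1 h3
    omega
  obtain ⟨w, rfl⟩ := Nat.exists_eq_add_of_le ht
  rw [pow_add, pow_add, pow_add]
  calc 2 ^ v * 2 ^ g ∣ (2 ^ t * j.choose (2 ^ t * u)) * 2 ^ g := mul_dvd_mul_right h2 _
    _ ∣ _ := ⟨2 ^ w, by ring⟩

theorem two_pow_dvd_two_pow_mul_stirlingSecond {p m v g : ℕ} (hm0 : m ≠ 0)
    (hv : 2 ^ v ∣ p + m) (hg : g ≤ m) (hm : m < 2 ^ (m - g)) :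
    2 ^ (v + g) ∣ 2 ^ m * Nat.stirlingSecond (p + m) p := by
  rw [stirlingSecond_add_left, Finset.mul_sum]
  refine Finset.dvd_sum fun r hr => ?_
  rw [← mul_assoc]
  refine Dvd.dvd.mul_right ?_ _
  simp only [Finset.mem_range] at hr
  exact two_pow_dvd_two_pow_mul_choose hv (by omega) (by omega) hg hm

theorem mul_add_three_le_two_pow (m : ℕ) (hm : 4 ≤ m) : m * (m + 3) ≤ 2 ^ (m + 1) := by
  induction m, hm using Nat.le_induction with
  | base => norm_num
  | succ m hm ih => rw [pow_succ]; nlinarith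

/-- The surplus g must compensate for p + m exceeding 2^(c+1): c + 1 + g is the L later supplied to
`padicValNat_add_padicValNat_lt`. -/
theorem exists_two_pow_dvd_two_pow_mul_stirlingSecond {p m v c : ℕ} (hm0 : m ≠ 0)
    (hv : 2 ^ v ∣ p + m) (hc : 1 ≤ c) (hp : p < 2 ^ (c + 1)) :
    ∃ g, 2 ^ (v + g) ∣ 2 ^ m * Nat.stirlingSecond (p + m) p ∧ p + m ≤ 2 ^ (c + 1 + g) := by
  have hc4 : 4 ≤ 2 ^ (c + 1) := by
    calc 4 = 2 ^ (1 + 1) := by norm_num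
      _ ≤ _ := Nat.pow_le_pow_right (by norm_num) (by omega)
  by_cases h1 : m = 1
  · subst h1
    exact ⟨0, two_pow_dvd_two_pow_mul_stirlingSecond hm0 hv (by omega) (by norm_num),
      by simpa using hp⟩
  by_cases h2 : m = 2
  · subst h2
    by_cases hp1 : p + 1 < 2 ^ (c + 1)
    · exact ⟨0, two_pow_dvd_two_pow_mul_stirlingSecond hm0 hv (by omega) (by norm_num),
        by rw [add_zero]; omega⟩
    -- Here p + 2 is odd, so v = 0 and the factor 2^m alone supplies g = 2.
    · have hp2 : p + 1 = 2 ^ (c + 1) := by omega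
      refine ⟨2, ?_, ?_⟩
      · have hv0 : v = 0 := by
          by_contra hv0
          have : 2 ∣ p + 2 := (dvd_pow_self 2 hv0).trans hv
          rw [pow_succ] at hp2
          omega
        subst hv0
        simp
      · rw [pow_add _ (c + 1)]; omega
  by_cases h3 : m = 3
  · subst h3
    refine ⟨1, two_pow_dvd_two_pow_mul_stirlingSecond hm0 hv (by omega) (by norm_num), ?_⟩
    rw [pow_add _ (c + 1)]; omega
  have hlog := Nat.lt_pow_succ_log_self (b := 2) (by norm_num) m
  have hlog' := Nat.pow_log_le_self 2 hm0
  have hlt : Nat.log 2 m < m := Nat.log_lt_self 2 hm0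
  -- This is the largest g with m < 2^(m-g).
  refine ⟨m - 1 - Nat.log 2 m, two_pow_dvd_two_pow_mul_stirlingSecond hm0 hv (by omega) ?_, ?_⟩
  · rwa [show m - (m - 1 - Nat.log 2 m) = Nat.log 2 m + 1 by omega]
  · obtain ⟨g, hg⟩ : ∃ g, m = g + 1 + Nat.log 2 m := ⟨m - 1 - Nat.log 2 m, by omega⟩
    have hg' : m - 1 - Nat.log 2 m = g := by omega
    rw [hg', pow_add]
    have h4 := mul_add_three_le_two_pow m (by omega)
    have h5 : 2 ^ (m + 1) = 2 ^ (g + 2) * 2 ^ Nat.log 2 m := by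
      rw [← pow_add]; congr 1; omega
    have h6 : m * (m + 3) ≤ m * 2 ^ (g + 2) := by
      calc _ ≤ _ := h4
        _ = 2 ^ Nat.log 2 m * 2 ^ (g + 2) := by rw [h5, mul_comm]
        _ ≤ _ := Nat.mul_le_mul_right _ hlog'
    have h7 : m + 3 ≤ 2 ^ (g + 2) := Nat.le_of_mul_le_mul_left h6 (Nat.pos_of_ne_zero hm0)
    rw [pow_add] at h7
    have h8 : 1 ≤ 2 ^ g := Nat.one_le_two_pow
    nlinarith

/-- The smaller valuation is at most that of the sum; the larger is below L, since a power of 2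
dividing one summand is less than the sum. -/
theorem padicValNat_add_padicValNat_lt {l l' L : ℕ} (hl : l ≠ 0) (hl' : l' ≠ 0)
    (h : l + l' ≤ 2 ^ L) :
    padicValNat 2 l + padicValNat 2 l' + 1 ≤ padicValNat 2 (l + l') + L := by
  wlog hle : padicValNat 2 l ≤ padicValNat 2 l' generalizing l l'
  · have := this hl' hl (by omega) (by omega)
    rw [add_comm l' l] at this
    omega
  have h1 : 2 ^ padicValNat 2 l ∣ l := pow_padicValNat_dvd
  have h2 : 2 ^ padicValNat 2 l' ∣ l' := pow_padicValNat_dvd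
  have h3 : padicValNat 2 l ≤ padicValNat 2 (l + l') :=
    (padicValNat_dvd_iff_le (by omega)).1 (dvd_add h1 ((pow_dvd_pow 2 hle).trans h2))
  have h4 : 2 ^ padicValNat 2 l' < 2 ^ L :=
    lt_of_le_of_lt (Nat.le_of_dvd (Nat.pos_of_ne_zero hl') h2) (by omega)
  have := (Nat.pow_lt_pow_iff_right (by norm_num : 1 < 2)).1 h4
  omega

/-- Neighbours in row d - 1 of Pascal's triangle add up to C(d,r+1), which is even for 0 < r + 1 <
2^c, so oddness spreads from the first entry. -/
theorem odd_choose_pred {d c r : ℕ} (hd : d ≠ 0) (hdvd : 2 ^ c ∣ d) (hr : r < 2 ^ c) :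
    Odd ((d - 1).choose r) := by
  obtain ⟨d, rfl⟩ := Nat.exists_eq_succ_of_ne_zero hd
  simp only [Nat.succ_eq_add_one, Nat.add_sub_cancel]
  induction r with
  | zero => simp
  | succ r ih =>
    have h1 := ih (by omega)
    have h2 : Even ((d + 1).choose (r + 1)) := by
      by_contra hodd
      rw [Nat.not_even_iff_odd] at hodd
      have h3 : 2 ^ c ∣ (d + 1).choose (r + 1) * (r + 1) := by
        rw [← Nat.add_one_mul_choose_eq]
        exact hdvd.mul_right _
      have h4 := ((Nat.coprime_two_left.2 hodd).pow_left c).dvd_of_dvd_mul_left h3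
      have := Nat.le_of_dvd (by omega) h4
      omega
    rw [Nat.choose_succ_succ] at h2
    rcases Nat.even_or_odd (d.choose (r + 1)) with h | h
    · exact absurd h2 (Nat.not_even_iff_odd.2 (h1.add_even h))
    · exact h

/-! ### Calculus of 2-adic bounds and exact valuations. -/

/-- `z` is divisible by `2 ^ t` in the sense that `ν(z) ≥ t`. -/
def PadicDvd (t : ℤ) (z : ℚ_[2]) : Prop := ‖z‖ ≤ (2 : ℝ) ^ (-t)

/-- `ν(z) = t`. -/
def PadicExact (t : ℤ) (z : ℚ_[2]) : Prop := ‖z‖ = (2 : ℝ) ^ (-t)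

theorem PadicDvd.mono {s t : ℤ} {z : ℚ_[2]} (h : PadicDvd t z) (hst : s ≤ t) : PadicDvd s z :=
  le_trans h (zpow_le_zpow_right₀ (by norm_num) (by omega))

theorem PadicDvd.zero (t : ℤ) : PadicDvd t 0 := by
  unfold PadicDvd; rw [norm_zero]; positivity

theorem PadicDvd.add {t : ℤ} {z w : ℚ_[2]} (hz : PadicDvd t z) (hw : PadicDvd t w) :
    PadicDvd t (z + w) :=
  (Padic.nonarchimedean z w).trans (max_le hz hw)

theorem PadicDvd.sum {ι : Type*} {t : ℤ} {s : Finset ι} {f : ι → ℚ_[2]}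
    (h : ∀ i ∈ s, PadicDvd t (f i)) : PadicDvd t (∑ i ∈ s, f i) :=
  Finset.sum_induction f (PadicDvd t) (fun _ _ => PadicDvd.add) (PadicDvd.zero t) h

theorem PadicDvd.mul {s t : ℤ} {z w : ℚ_[2]} (hz : PadicDvd s z) (hw : PadicDvd t w) :
    PadicDvd (s + t) (z * w) := by
  unfold PadicDvd at *
  rw [norm_mul, neg_add, zpow_add₀ (by norm_num)]
  exact mul_le_mul hz hw (norm_nonneg _) (by positivity)

theorem PadicExact.mul {s t : ℤ} {z w : ℚ_[2]} (hz : PadicExact s z) (hw : PadicExact t w) :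
    PadicExact (s + t) (z * w) := by
  unfold PadicExact at *
  rw [norm_mul, neg_add, zpow_add₀ (by norm_num), hz, hw]

theorem PadicExact.div {s t : ℤ} {z w : ℚ_[2]} (hz : PadicExact s z) (hw : PadicExact t w) :
    PadicExact (s - t) (z / w) := by
  unfold PadicExact at *
  rw [norm_div, hz, hw, ← zpow_sub₀ (by norm_num)]
  congr 1; ring

theorem PadicExact.dvd {t : ℤ} {z : ℚ_[2]} (h : PadicExact t z) : PadicDvd t z := le_of_eq h

theorem PadicExact.add_dvd {t : ℤ} {z w : ℚ_[2]} (hz : PadicExact t z)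
    (hw : PadicDvd (t + 1) w) : PadicExact t (z + w) := by
  have hlt : ‖w‖ < ‖z‖ := by
    rw [hz]
    exact lt_of_le_of_lt hw (zpow_lt_zpow_right₀ (by norm_num) (by omega))
  unfold PadicExact
  rw [Padic.add_eq_max_of_ne hlt.ne', max_eq_left hlt.le, hz]

theorem PadicExact.sum {ι : Type*} {t : ℤ} {s : Finset ι} {f : ι → ℚ_[2]} {i₀ : ι}
    (hi₀ : i₀ ∈ s) (h₀ : PadicExact t (f i₀))
    (h : ∀ i ∈ s, i ≠ i₀ → PadicDvd (t + 1) (f i)) : PadicExact t (∑ i ∈ s, f i) := by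
  classical
  rw [← Finset.add_sum_erase s f hi₀]
  refine h₀.add_dvd (PadicDvd.sum fun i hi => ?_)
  rw [Finset.mem_erase] at hi
  exact h i hi.2 hi.1

theorem padicExact_natCast {n : ℕ} (hn : n ≠ 0) :
    PadicExact (padicValNat 2 n) (n : ℚ_[2]) := by
  unfold PadicExact
  rw [Padic.norm_eq_zpow_neg_valuation (by exact_mod_cast hn), Padic.valuation_natCast]
  norm_num

theorem padicDvd_natCast_of_dvd {n t : ℕ} (h : 2 ^ t ∣ n) : PadicDvd t (n : ℚ_[2]) := by
  rcases eq_or_ne n 0 with rfl | hn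
  · simpa using PadicDvd.zero _
  · refine (padicExact_natCast hn).dvd.mono ?_
    exact_mod_cast (padicValNat_dvd_iff_le hn).1 h

theorem padicDvd_zero_natCast (n : ℕ) : PadicDvd 0 (n : ℚ_[2]) := by
  simpa using padicDvd_natCast_of_dvd (n := n) (t := 0) (by simp)

theorem padicExact_zero_of_odd {n : ℕ} (h : Odd n) : PadicExact 0 (n : ℚ_[2]) := by
  have hn : n ≠ 0 := by rintro rfl; simp at h
  have := padicExact_natCast hn
  rwa [padicValNat.eq_zero_of_not_dvd (by rw [← even_iff_two_dvd]; simpa using h)] at this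

theorem padicExact_two_pow (n : ℕ) : PadicExact n ((2 : ℚ_[2]) ^ n) := by
  unfold PadicExact
  have := Padic.norm_p_pow (p := 2) n
  exact_mod_cast this

theorem choose_succ_eq_div (d l : ℕ) :
    (d.choose (l + 1) : ℚ_[2]) = (d : ℚ_[2]) / ((l + 1 : ℕ) : ℚ_[2]) * ((d - 1).choose l : ℕ) := by
  have hl : ((l + 1 : ℕ) : ℚ_[2]) ≠ 0 := by exact_mod_cast Nat.succ_ne_zero l
  rcases d with _ | d
  · simp
  · rw [eq_comm, div_mul_eq_mul_div, div_eq_iff hl]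
    exact_mod_cast Nat.add_one_mul_choose_eq d l

theorem padicDvd_choose {d t l : ℕ} (h : 2 ^ t ∣ d) (hl : l ≠ 0) :
    PadicDvd ((t : ℤ) - padicValNat 2 l) (d.choose l : ℚ_[2]) := by
  rcases eq_or_ne d 0 with rfl | hd
  · rw [Nat.choose_eq_zero_of_lt (Nat.pos_of_ne_zero hl)]
    simpa using PadicDvd.zero _
  obtain ⟨l, rfl⟩ := Nat.exists_eq_succ_of_ne_zero hl
  rw [Nat.succ_eq_add_one, choose_succ_eq_div]
  have := (((padicExact_natCast hd).div (padicExact_natCast hl)).dvd).mul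
    (padicDvd_zero_natCast ((d - 1).choose l))
  refine this.mono ?_
  have : t ≤ padicValNat 2 d := (padicValNat_dvd_iff_le hd).1 h
  simp only [Nat.succ_eq_add_one]
  omega

theorem padicExact_choose {d c l : ℕ} (hd : d ≠ 0) (h : 2 ^ c ∣ d) (hl : l ≠ 0)
    (hlc : l ≤ 2 ^ c) :
    PadicExact ((padicValNat 2 d : ℤ) - padicValNat 2 l) (d.choose l : ℚ_[2]) := by
  obtain ⟨l, rfl⟩ := Nat.exists_eq_succ_of_ne_zero hl
  rw [Nat.succ_eq_add_one, choose_succ_eq_div]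
  have := ((padicExact_natCast hd).div (padicExact_natCast hl)).mul
    (padicExact_zero_of_odd (odd_choose_pred hd h (by omega : l < 2 ^ c)))
  rwa [add_zero] at this

/-! ### Exact valuation of increments. -/

section Difference

variable {n c E p₀ : ℕ}

/-- `p₀` is the index whose contribution determines the valuation of the increments of
`T_{n+1}` on multiples of `2 ^ c`. -/
structure IsDominantIndex (n c E p₀ : ℕ) : Prop where
  one_le : 1 ≤ c
  lt_of_le : ∀ p, 2 * p ≤ n → p < 2 ^ (c + 1)
  ne_zero : p₀ ≠ 0
  even : Even p₀
  le_two_pow : p₀ ≤ 2 ^ c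
  exact : PadicExact ((padicValNat 2 p₀ : ℤ) - E) (newtonWeight n p₀ : ℚ_[2])
  dvd : ∀ p, p ≠ 0 → 2 * p ≤ n → p ≠ p₀ →
    PadicDvd ((padicValNat 2 p : ℤ) - E + 1) (newtonWeight n p : ℚ_[2])

/-- The slack ε is 1 away from p₀. At p₀ it vanishes, and evenness of p₀ supplies the missing factor
2 in the terms with m ≠ 0. -/
theorem IsDominantIndex.dvd_weight (H : IsDominantIndex n c E p₀) {p : ℕ} (hp : p ≠ 0)
    (hpn : 2 * p ≤ n) :
    ∃ ε : ℕ, PadicDvd ((padicValNat 2 p : ℤ) - E + ε) (newtonWeight n p : ℚ_[2]) ∧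
      1 ≤ padicValNat 2 p + ε ∧ (p ≠ p₀ → ε = 1) := by
  by_cases h : p = p₀
  · subst h
    refine ⟨0, by simpa using H.exact.dvd, ?_, by simp⟩
    exact one_le_padicValNat_of_dvd hp H.even.two_dvd
  · exact ⟨1, by simpa using H.dvd p hp hpn h, by omega, fun _ => rfl⟩

/-- With j = l + l', the losses ν(l), ν(l') from the two binomials are repaid by ν(j), which comes
from 2^m S(j,p) if m > 0 and from the weight if m = 0 (then j = p). -/
theorem IsDominantIndex.dvd_term (H : IsDominantIndex n c E p₀) {k d D p m l l' : ℕ}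
    (hk : 2 ^ c ∣ k) (hd : 2 ^ D ∣ d) (hl : l ≠ 0) (hj : l + l' = p + m)
    (hne : ¬ (p = p₀ ∧ m = 0 ∧ l' = 0)) :
    PadicDvd ((D : ℤ) - E + 1) ((newtonWeight n p : ℚ_[2]) *
      ((2 ^ m * Nat.stirlingSecond (p + m) p : ℕ) : ℚ_[2]) *
        ((d.choose l : ℚ_[2]) * (k.choose l' : ℚ_[2]))) := by
  by_cases hpn : 2 * p ≤ n
  swap
  · rw [newtonWeight, if_neg hpn]
    simpa using PadicDvd.zero _
  rcases eq_or_ne p 0 with rfl | hp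
  · obtain ⟨m, rfl⟩ := Nat.exists_eq_succ_of_ne_zero (by omega : m ≠ 0)
    rw [zero_add, Nat.succ_eq_add_one, Nat.stirlingSecond_succ_zero]
    simpa using PadicDvd.zero _
  obtain ⟨ε, hW, hε, hε'⟩ := H.dvd_weight hp hpn
  have hlt := H.lt_of_le p hpn
  have hdl := padicDvd_choose hd hl
  have hvj : 2 ^ padicValNat 2 (p + m) ∣ p + m := pow_padicValNat_dvd
  rcases eq_or_ne m 0 with rfl | hm
  · have hS : PadicDvd 0 ((2 ^ 0 * Nat.stirlingSecond (p + 0) p : ℕ) : ℚ_[2]) :=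
      padicDvd_zero_natCast _
    rcases eq_or_ne l' 0 with rfl | hl'
    · have hε1 := hε' (by tauto)
      have h := (hW.mul hS).mul (hdl.mul (padicDvd_zero_natCast (k.choose 0)))
      refine h.mono ?_
      have : l = p := by omega
      subst this
      omega
    · have h := (hW.mul hS).mul (hdl.mul (padicDvd_choose hk hl'))
      refine h.mono ?_
      have hcase : p ≤ 2 ^ (c + ε) := by
        by_cases hpp : p = p₀
        · rw [hpp]
          exact H.le_two_pow.trans (Nat.pow_le_pow_right (by norm_num) (by omega))
        · rw [hε' hpp]; omega
      have h3 := padicValNat_add_padicValNat_lt hl hl' (L := c + ε) (by omega)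
      rw [hj, add_zero] at h3
      omega
  · obtain ⟨g, hg, hgle⟩ :=
      exists_two_pow_dvd_two_pow_mul_stirlingSecond hm hvj H.one_le hlt
    have hS := padicDvd_natCast_of_dvd hg
    rcases eq_or_ne l' 0 with rfl | hl'
    · have h := (hW.mul hS).mul (hdl.mul (padicDvd_zero_natCast (k.choose 0)))
      refine h.mono ?_
      rw [add_zero] at hj
      subst hj
      omega
    · have h := (hW.mul hS).mul (hdl.mul (padicDvd_choose hk hl'))
      refine h.mono ?_
      have h3 := padicValNat_add_padicValNat_lt hl hl' (L := c + 1 + g) (by omega)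
      rw [hj] at h3
      omega

theorem IsDominantIndex.exact_add_sub (H : IsDominantIndex n c E p₀) {k d : ℕ}
    (hk : 2 ^ c ∣ k) (hd : d ≠ 0) (hcd : 2 ^ c ∣ d) :
    PadicExact ((n : ℤ) + padicValNat 2 d - E)
      (((partialStirling (n + 1) ((k + d : ℕ) : ℤ) : ℚ) : ℚ_[2]) -
        ((partialStirling (n + 1) (k : ℤ) : ℚ) : ℚ_[2])) := by
  have hdD : 2 ^ padicValNat 2 d ∣ d := pow_padicValNat_dvd
  have hpd : p₀ ≤ d := H.le_two_pow.trans (Nat.le_of_dvd (Nat.pos_of_ne_zero hd) hcd)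
  have hterm : ∀ j p l : ℕ, p ∈ Finset.range (j + 1) → l ∈ Finset.range j →
      ¬ (j = p₀ ∧ p = p₀ ∧ l = p₀ - 1) →
      PadicDvd ((padicValNat 2 d : ℤ) - E + 1) ((newtonWeight n p : ℚ_[2]) *
        ((2 ^ (j - p) * Nat.stirlingSecond j p : ℕ) : ℚ_[2]) *
          ((d.choose (l + 1) : ℚ_[2]) * (k.choose (j - (l + 1)) : ℚ_[2]))) := by
    intro j p l hp hl hne
    rw [Finset.mem_range] at hp hl
    obtain ⟨m, rfl⟩ := Nat.exists_eq_add_of_le (Nat.lt_succ_iff.1 hp)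
    rw [Nat.add_sub_cancel_left]
    exact H.dvd_term hk hdD (Nat.succ_ne_zero l) (by omega) (by omega)
  have hp₀ := H.ne_zero
  have hmain : PadicExact ((padicValNat 2 d : ℤ) - E) (∑ j ∈ Finset.range (k + d + 1),
      ∑ p ∈ Finset.range (j + 1), ∑ l ∈ Finset.range j, ((newtonWeight n p : ℚ_[2]) *
        ((2 ^ (j - p) * Nat.stirlingSecond j p : ℕ) : ℚ_[2]) *
          ((d.choose (l + 1) : ℚ_[2]) * (k.choose (j - (l + 1)) : ℚ_[2])))) := by
    refine PadicExact.sum (i₀ := p₀) (by rw [Finset.mem_range]; omega) ?_ ?_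
    · refine PadicExact.sum (i₀ := p₀) (by rw [Finset.mem_range]; omega) ?_ ?_
      · refine PadicExact.sum (i₀ := p₀ - 1) (by rw [Finset.mem_range]; omega) ?_ ?_
        · rw [Nat.sub_add_cancel (by omega : 1 ≤ p₀)]
          have h := H.exact.mul (padicExact_choose hd hcd hp₀ H.le_two_pow)
          simp only [Nat.sub_self, pow_zero, Nat.stirlingSecond_self, Nat.choose_zero_right,
            Nat.cast_one, mul_one]
          convert h using 1
          ring
        · intro l hl hne
          exact hterm _ _ _ (by simp) hl (by tauto)
      · intro p hp hne
        exact PadicDvd.sum fun l hl => hterm _ _ _ hp hl (by tauto)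
    · intro j _ hne
      exact PadicDvd.sum fun p hp => PadicDvd.sum fun l hl => hterm _ _ _ hp hl (by tauto)
  rw [← Rat.cast_sub, partialStirling_add_sub]
  have h := (padicExact_two_pow n).mul hmain
  push_cast at h ⊢
  convert h using 1
  ring

end Difference

/-! ### Weights and dominant indices. -/

theorem choose_two_pow_mul_add_modEq (i a b r : ℕ) (hr : r < 2 ^ i) :
    (2 ^ i * a + r).choose (2 ^ i * b) ≡ a.choose b [MOD 2] := by
  induction i generalizing r with
  | zero =>
    obtain rfl : r = 0 := by simpa using hr
    simp [Nat.ModEq.refl]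
  | succ i ih =>
    have h := Choose.choose_modEq_choose_mod_mul_choose_div_nat (p := 2)
      (n := 2 ^ (i + 1) * a + r) (k := 2 ^ (i + 1) * b)
    have e1 : 2 ^ (i + 1) * b % 2 = 0 := by
      rw [pow_succ', mul_assoc, Nat.mul_mod_right]
    have e2 : 2 ^ (i + 1) * b / 2 = 2 ^ i * b := by
      rw [pow_succ', mul_assoc, Nat.mul_div_cancel_left _ (by norm_num)]
    have e3 : (2 ^ (i + 1) * a + r) / 2 = 2 ^ i * a + r / 2 := by
      rw [pow_succ', mul_assoc, Nat.mul_add_div (by norm_num)]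
    rw [e1, e2, e3, Nat.choose_zero_right, one_mul] at h
    exact h.trans (ih (r / 2) (by rw [pow_succ] at hr; omega))

/-- By Legendre, p - ν(p!) is the binary digit sum of p; it reaches e only if all e digits are 1. -/
theorem le_padicValNat_factorial_add {p e : ℕ} (hp : p < 2 ^ e) :
    p ≤ padicValNat 2 p.factorial + e ∧ (p = padicValNat 2 p.factorial + e → p + 1 = 2 ^ e) := by
  induction e generalizing p with
  | zero =>
    obtain rfl : p = 0 := by simpa using hp
    simp
  | succ e ih =>
    rw [pow_succ] at hp ⊢
    have ih' := ih (p := p / 2) (by omega)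
    have h1 := padicValNat_factorial_mul_add (p := 2) (n := p % 2) (p / 2) (Nat.mod_lt _ (by simp))
    rw [padicValNat_factorial_mul, Nat.div_add_mod] at h1
    have h2 := Nat.div_add_mod p 2
    have h3 : p % 2 < 2 := Nat.mod_lt _ (by simp)
    omega

/-- Digit sum plus number of trailing zeros is at most e, with equality only if every digit above
the trailing zeros is 1. -/
theorem add_padicValNat_le_padicValNat_factorial_add {p e : ℕ} (h0 : p ≠ 0) (hp : p < 2 ^ e) :
    p + padicValNat 2 p ≤ padicValNat 2 p.factorial + e ∧
      (p + padicValNat 2 p = padicValNat 2 p.factorial + e → ∃ i < e, p + 2 ^ i = 2 ^ e) := by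
  induction e generalizing p with
  | zero => simp at hp; omega
  | succ e ih =>
    rcases Nat.even_or_odd' p with ⟨q, rfl | rfl⟩
    · have hq : q ≠ 0 := by omega
      rw [pow_succ] at hp
      obtain ⟨h1, h2⟩ := ih hq (by omega)
      rw [padicValNat_factorial_mul, padicValNat.mul (by norm_num) hq, padicValNat_self]
      refine ⟨by omega, fun h => ?_⟩
      obtain ⟨i, hi, hi'⟩ := h2 (by omega)
      exact ⟨i + 1, by omega, by rw [pow_succ, pow_succ]; omega⟩
    · have hv : padicValNat 2 (2 * q + 1) = 0 := padicValNat.eq_zero_of_not_dvd (by omega)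
      obtain ⟨h1, h2⟩ := le_padicValNat_factorial_add hp
      rw [hv]
      exact ⟨by omega, fun h => ⟨0, by omega, by simpa using h2 (by omega)⟩⟩

theorem newtonWeight_eq {n p : ℕ} (h : 2 * p ≤ n) : (newtonWeight n p : ℚ_[2]) =
    (p.factorial : ℚ_[2]) / 2 ^ p * ((n - p).choose p : ℚ_[2]) := by
  rw [newtonWeight, if_pos h]
  push_cast
  ring

theorem padicExact_factorial_div (p : ℕ) :
    PadicExact ((padicValNat 2 p.factorial : ℤ) - p) ((p.factorial : ℚ_[2]) / 2 ^ p) :=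
  (padicExact_natCast p.factorial_ne_zero).div (padicExact_two_pow p)

/-- Only p = 2^e - 2^i' can make ν(p!/2^p) - ν(p) equal to its minimum -e. Among these, i' < i
violates 2p ≤ n; by Lucas, C(n-p,p) is odd for i' = i and even for i' > i. -/
theorem isDominantIndex_of_mem_dyadic {n c e i : ℕ} (hc : 1 ≤ c)
    (hn : ∀ p, 2 * p ≤ n → p < 2 ^ (c + 1)) (hi0 : 1 ≤ i) (hie : i < e)
    (hle : 2 ^ (e + 1) ≤ n + 2 ^ (i + 1)) (hlt : n + 2 ^ i < 2 ^ (e + 1))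
    (hp₀ : 2 ^ e - 2 ^ i ≤ 2 ^ c) : IsDominantIndex n c e (2 ^ e - 2 ^ i) := by
  have hlt2 : 2 ^ i < 2 ^ e := Nat.pow_lt_pow_right (by norm_num) hie
  rw [pow_succ] at hle hlt
  rw [pow_succ] at hle
  obtain ⟨t, rfl⟩ := Nat.exists_eq_add_of_lt hie
  have hfac : 2 ^ (i + t + 1) - 2 ^ i = 2 ^ i * (2 ^ (t + 1) - 1) := by
    rw [Nat.mul_sub, mul_one, ← pow_add, add_assoc]
  have hodd : ¬ 2 ∣ 2 ^ (t + 1) - 1 := by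
    have := Nat.one_le_two_pow (n := t)
    rw [pow_succ]; omega
  have hvp₀ : padicValNat 2 (2 ^ (i + t + 1) - 2 ^ i) = i := by
    rw [hfac, padicValNat.mul (by positivity) (by rintro h; rw [h] at hodd; simp at hodd),
      padicValNat.prime_pow, padicValNat.eq_zero_of_not_dvd hodd, add_zero]
  set e := i + t + 1 with he
  set p₀ := 2 ^ e - 2 ^ i with hp₀def
  have hp₀n : 2 * p₀ ≤ n := by omega
  have hp₀0 : p₀ ≠ 0 := by omega
  have heven : Even p₀ := by
    rw [hfac]
    exact (Nat.even_pow.2 ⟨even_two, by omega⟩).mul_right _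
  refine ⟨hc, hn, hp₀0, heven, hp₀, ?_, ?_⟩
  · have hch : Odd ((n - p₀).choose p₀) := by
      have h := choose_two_pow_mul_add_modEq i (2 ^ (t + 1) - 1) (2 ^ (t + 1) - 1) (n - 2 * p₀)
        (by omega)
      rw [← hfac, Nat.choose_self, show p₀ + (n - 2 * p₀) = n - p₀ by omega] at h
      exact Nat.odd_iff.2 h
    have hval : p₀ + i = padicValNat 2 p₀.factorial + e := by
      have h := (add_padicValNat_le_padicValNat_factorial_add hp₀0 (by omega : p₀ < 2 ^ e)).1
      rw [hvp₀] at h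
      refine le_antisymm h ?_
      have hfact : ∀ m u : ℕ, padicValNat 2 (2 ^ m * u).factorial + u =
          padicValNat 2 u.factorial + 2 ^ m * u := by
        intro m u
        induction m with
        | zero => simp
        | succ m ih =>
          rw [pow_succ', mul_assoc, padicValNat_factorial_mul]
          omega
      have hones : ∀ m : ℕ, padicValNat 2 (2 ^ m - 1).factorial + m + 1 = 2 ^ m := by
        intro m
        induction m with
        | zero => simp
        | succ m ih =>
          have h1 := Nat.one_le_two_pow (n := m)
          have h2 : 2 ^ (m + 1) - 1 = 2 * (2 ^ m - 1) + 1 := by rw [pow_succ]; omega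
          rw [h2, padicValNat_factorial_mul_add _ (by norm_num), padicValNat_factorial_mul,
            pow_succ]
          omega
      have h1 := hfact i (2 ^ (t + 1) - 1)
      have h2 := hones (t + 1)
      rw [← hfac] at h1
      omega
    rw [newtonWeight_eq hp₀n, hvp₀]
    convert (padicExact_factorial_div p₀).mul (padicExact_zero_of_odd hch) using 1
    omega
  · intro p hp hpn hne
    rw [newtonWeight_eq hpn]
    obtain ⟨h1, h2⟩ := add_padicValNat_le_padicValNat_factorial_add hp (by omega : p < 2 ^ e)
    rcases h1.lt_or_eq with h1 | h1
    · refine ((padicExact_factorial_div p).dvd.mul (padicDvd_zero_natCast _)).mono ?_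
      omega
    · obtain ⟨i', hi', hpi⟩ := h2 h1
      have hlt : i < i' := by
        by_contra hcon
        rcases (not_lt.1 hcon).lt_or_eq with h | rfl
        · have : 2 ^ (i' + 1) ≤ 2 ^ i := Nat.pow_le_pow_right (by norm_num) h
          rw [pow_succ] at this
          omega
        · omega
      have hpow : 2 ^ (i + 1) ≤ 2 ^ i' := Nat.pow_le_pow_right (by norm_num) hlt
      rw [pow_succ] at hpow
      obtain ⟨t', ht'⟩ := Nat.exists_eq_add_of_lt hi'
      have hpe : p = 2 ^ i' * (2 ^ (t' + 1) - 1) := by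
        rw [Nat.mul_sub, mul_one, ← pow_add, ← add_assoc, ← ht']; omega
      have hev : 2 ^ 1 ∣ (n - p).choose p := by
        have h := choose_two_pow_mul_add_modEq i' (2 ^ (t' + 1) - 1 + 1) (2 ^ (t' + 1) - 1)
          (n - 2 * p - 2 ^ i') (by omega)
        rw [Nat.mul_add, ← hpe, mul_one,
          show p + 2 ^ i' + (n - 2 * p - 2 ^ i') = n - p by omega, Nat.choose_succ_self_right,
          Nat.sub_add_cancel Nat.one_le_two_pow] at h
        refine (Nat.modEq_zero_iff_dvd).1 (h.trans ?_)
        rw [Nat.modEq_zero_iff_dvd]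
        exact dvd_pow_self 2 (Nat.succ_ne_zero t')
      refine ((padicExact_factorial_div p).dvd.mul (padicDvd_natCast_of_dvd hev)).mono ?_
      omega

theorem norm_prod_congr_norm {ι : Type*} (s : Finset ι) (f g : ι → ℚ_[2])
    (h : ∀ i ∈ s, ‖f i‖ = ‖g i‖) : ‖∏ i ∈ s, f i‖ = ‖∏ i ∈ s, g i‖ := by
  rw [norm_prod, norm_prod]
  exact Finset.prod_congr rfl h

theorem norm_two_pow_sub {e t : ℕ} (h0 : t ≠ 0) (ht : t < 2 ^ e) :
    ‖((2 ^ e - t : ℕ) : ℚ_[2])‖ = ‖(t : ℚ_[2])‖ := by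
  have hv : padicValNat 2 t < e := by
    refine (Nat.pow_lt_pow_iff_right (by norm_num : 1 < 2)).1 (lt_of_le_of_lt ?_ ht)
    exact Nat.le_of_dvd (Nat.pos_of_ne_zero h0) pow_padicValNat_dvd
  have h1 := padicExact_natCast h0
  have h2 : PadicExact (padicValNat 2 t) (-(t : ℚ_[2])) := by
    unfold PadicExact at *; rwa [norm_neg]
  have h3 := h2.add_dvd ((padicExact_two_pow e).dvd.mono (by omega))
  rw [Nat.cast_sub ht.le, Nat.cast_pow, Nat.cast_ofNat, sub_eq_neg_add]
  exact h3.trans h1.symm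

/-- Modulo reflection t ↦ 2^e - t, which preserves the norm, p! C(n-p,p) becomes (2p)!/p!, of
valuation p. -/
theorem padicExact_newtonWeight_two_pow_sub_one {e p : ℕ} (h : 2 * p ≤ 2 ^ e - 1) :
    PadicExact 0 (newtonWeight (2 ^ e - 1) p : ℚ_[2]) := by
  have hpos := Nat.one_le_two_pow (n := e)
  have h1 : ‖((2 ^ e - 1 - p).descFactorial p : ℚ_[2])‖ = ‖((p + 1).ascFactorial p : ℚ_[2])‖ := by
    rw [Nat.descFactorial_eq_prod_range, Nat.ascFactorial_eq_prod_range, Nat.cast_prod,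
      Nat.cast_prod]
    refine norm_prod_congr_norm _ _ _ fun i hi => ?_
    rw [Finset.mem_range] at hi
    rw [show 2 ^ e - 1 - p - i = 2 ^ e - (p + 1 + i) by omega]
    exact norm_two_pow_sub (by omega) (by omega)
  have h2 : padicValNat 2 ((p + 1).ascFactorial p) = p := by
    have h3 := Nat.factorial_mul_ascFactorial p p
    have h4 := congrArg (padicValNat 2) h3
    rw [padicValNat.mul p.factorial_ne_zero (Nat.ascFactorial_pos _ _).ne', ← two_mul,
      padicValNat_factorial_mul] at h4
    omega
  have h3 := padicExact_natCast (n := (p + 1).ascFactorial p) (Nat.ascFactorial_pos _ _).ne'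
  rw [h2] at h3
  have h4 : PadicExact p ((2 ^ e - 1 - p).descFactorial p : ℚ_[2]) := h1.trans h3
  have h5 := h4.div (padicExact_two_pow p)
  rw [sub_self, Nat.descFactorial_eq_factorial_mul_choose] at h5
  rw [newtonWeight_eq h]
  convert h5 using 1
  push_cast
  ring

/-- All weights are units, so the index of largest valuation dominates; among 0 < p < 2^(c+1) that
is 2^c. -/
theorem isDominantIndex_two_pow_sub_one {c : ℕ} (hc : 1 ≤ c) :
    IsDominantIndex (2 ^ (c + 2) - 1) c c (2 ^ c) := by
  have hpow : 2 ^ (c + 2) = 4 * 2 ^ c := by ring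
  have hpow' : 2 ^ (c + 1) = 2 * 2 ^ c := by ring
  have hpos := Nat.one_le_two_pow (n := c)
  refine ⟨hc, fun p hp => by omega, by positivity, Nat.even_pow.2 ⟨even_two, by omega⟩, le_rfl,
    ?_, ?_⟩
  · rw [padicValNat.prime_pow, sub_self]
    exact padicExact_newtonWeight_two_pow_sub_one (by omega)
  · intro p hp hpn hne
    refine (padicExact_newtonWeight_two_pow_sub_one hpn).dvd.mono ?_
    have hv : padicValNat 2 p < c := by
      by_contra hcon
      obtain ⟨q, hq⟩ := (pow_dvd_pow 2 (not_lt.1 hcon)).trans (pow_padicValNat_dvd (p := 2) (n := p))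
      rcases q with _ | _ | q
      · omega
      · omega
      · have : 2 ^ c * (q + 1 + 1) = 2 ^ c * q + 2 * 2 ^ c := by ring
        have := Nat.zero_le (2 ^ c * q)
        omega
    omega

/-! ### Zeros of 2-adic isometries. -/

theorem norm_sub_one_lt_one {z : ℚ_[2]} (hz : ‖z‖ = 1) : ‖z - 1‖ < 1 := by
  obtain ⟨y, rfl⟩ : ∃ y : ℤ_[2], (y : ℚ_[2]) = z := ⟨⟨z, hz.le⟩, rfl⟩
  obtain ⟨m, hm, hmem⟩ := PadicInt.exists_mem_range y
  rw [IsLocalRing.mem_maximalIdeal, PadicInt.mem_nonunits, PadicInt.norm_def] at hmem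
  rw [PadicInt.coe_sub, PadicInt.coe_natCast] at hmem
  interval_cases m
  · rw [Nat.cast_zero, sub_zero] at hmem
    exact absurd hz hmem.ne
  · rwa [Nat.cast_one] at hmem

/-- Scaled by 2^(-t), both are 1 modulo 2, and 1 + 1 = 2. -/
theorem PadicExact.add_exact {t : ℤ} {z w : ℚ_[2]} (hz : PadicExact t z) (hw : PadicExact t w) :
    PadicDvd (t + 1) (z + w) := by
  have h2 : PadicExact t ((2 : ℚ_[2]) ^ t) := by
    have := Padic.norm_p_zpow (p := 2) t
    exact_mod_cast this
  have h1 : ∀ {y : ℚ_[2]}, PadicExact t y → PadicDvd 1 (y / 2 ^ t - 1) := by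
    intro y hy
    have hy' : ‖y / 2 ^ t‖ = 1 := by
      have := hy.div h2
      rw [sub_self] at this
      simpa [PadicExact] using this
    have := norm_sub_one_lt_one hy'
    have h3 := (Padic.norm_lt_pow_iff_norm_le_pow_sub_one (p := 2) (y / 2 ^ t - 1) 0).1
      (by simpa using this)
    simpa [PadicDvd] using h3
  have h3 : PadicDvd 1 (2 : ℚ_[2]) := by simpa using (padicExact_two_pow 1).dvd
  have h4 := ((h3.add (h1 hz)).add (h1 hw)).mul h2.dvd
  have hne : (2 : ℚ_[2]) ^ t ≠ 0 := zpow_ne_zero _ (by norm_num)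
  rw [add_comm t 1]
  convert h4 using 1
  field_simp
  ring

theorem padicDvd_succ_or_exact {t : ℤ} {z : ℚ_[2]} (h : PadicDvd t z) :
    PadicDvd (t + 1) z ∨ PadicExact t z := by
  rcases lt_or_eq_of_le h with h | h
  · left
    have := (Padic.norm_lt_pow_iff_norm_le_pow_sub_one (p := 2) z (-t)).1 (by exact_mod_cast h)
    unfold PadicDvd
    rw [neg_add]
    exact_mod_cast this
  · exact Or.inr h

/-- Digit-by-digit search: if g x has valuation exactly N, adding 2^N to x changes g by another
element of valuation N, and the two leading digits cancel. -/
theorem exists_padicDvd_of_isometry {g : ℤ → ℚ_[2]} (h0 : ‖g 0‖ ≤ 1)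
    (h : ∀ x y, ‖g x - g y‖ = ‖((x - y : ℤ) : ℚ_[2])‖) (N : ℕ) : ∃ x, PadicDvd N (g x) := by
  induction N with
  | zero => exact ⟨0, by simpa [PadicDvd] using h0⟩
  | succ N ih =>
    obtain ⟨x, hx⟩ := ih
    push_cast
    rcases padicDvd_succ_or_exact hx with hx | hx
    · exact ⟨x, hx⟩
    · refine ⟨x + 2 ^ N, ?_⟩
      have h1 : PadicExact N (g (x + 2 ^ N) - g x) := by
        unfold PadicExact
        rw [h, add_sub_cancel_left]
        have := padicExact_two_pow N
        unfold PadicExact at this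
        exact_mod_cast this
      have := hx.add_exact h1
      rwa [add_sub_cancel] at this

/-- An isometric function on the integers with integral values measures the distance to some
2-adic integer, the zero of its continuous extension to `ℤ_[2]`. -/
theorem exists_zero_of_isometry {g : ℤ → ℚ_[2]} (h0 : ‖g 0‖ ≤ 1)
    (h : ∀ x y, ‖g x - g y‖ = ‖((x - y : ℤ) : ℚ_[2])‖) :
    ∃ xbar : ℤ_[2], ∀ x : ℤ, ‖g x‖ = ‖(x : ℚ_[2]) - (xbar : ℚ_[2])‖ := by
  choose u hu using exists_padicDvd_of_isometry h0 h
  have hlim : Filter.Tendsto (fun N : ℕ => (2 : ℝ) ^ (-(N : ℤ))) Filter.atTop (nhds 0) := by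
    simp_rw [zpow_neg, zpow_natCast, ← inv_pow]
    exact tendsto_pow_atTop_nhds_zero_of_lt_one (by norm_num) (by norm_num)
  have hg : Filter.Tendsto (fun N => g (u N)) Filter.atTop (nhds 0) :=
    squeeze_zero_norm hu hlim
  -- The isometry transfers the Cauchy property from g (u N) back to u N.
  have hcauchy : CauchySeq (fun N => ((u N : ℤ) : ℤ_[2])) := by
    have hgc := hg.cauchySeq
    rw [Metric.cauchySeq_iff] at hgc ⊢
    intro ε hε
    obtain ⟨N, hN⟩ := hgc ε hε
    refine ⟨N, fun a ha b hb => ?_⟩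
    have h1 := hN a ha b hb
    rw [dist_eq_norm, h] at h1
    rw [dist_eq_norm, PadicInt.norm_def]
    exact_mod_cast h1
  obtain ⟨xbar, hx⟩ := cauchySeq_tendsto_of_complete hcauchy
  refine ⟨xbar, fun x => ?_⟩
  have hx' : Filter.Tendsto (fun N => ((u N : ℤ) : ℚ_[2])) Filter.atTop
      (nhds (xbar : ℚ_[2])) := by
    have := (continuous_subtype_val.tendsto xbar).comp hx
    exact this.congr fun N => PadicInt.coe_intCast (u N)
  have h1 : Filter.Tendsto (fun N => ‖g x - g (u N)‖) Filter.atTop (nhds ‖g x‖) := by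
    simpa using (tendsto_const_nhds.sub hg).norm
  have h2 : Filter.Tendsto (fun N => ‖g x - g (u N)‖) Filter.atTop
      (nhds ‖(x : ℚ_[2]) - (xbar : ℚ_[2])‖) := by
    refine ((tendsto_const_nhds.sub hx').norm).congr fun N => ?_
    rw [h]
    push_cast
    rfl
  exact tendsto_nhds_unique h1 h2

/-! ### Integer exponents and conclusion. -/

/-- Continuity in the exponent, from Euler's theorem for odd i; it allows negative exponents to be
shifted to natural ones. -/
theorem padicDvd_partialStirling_add_two_pow_sub (n N : ℕ) (k : ℤ) :
    PadicDvd N (((partialStirling n (k + 2 ^ N) : ℚ) : ℚ_[2]) -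
      ((partialStirling n k : ℚ) : ℚ_[2])) := by
  unfold partialStirling
  push_cast
  rw [← Finset.sum_sub_distrib]
  refine PadicDvd.sum fun i hi => ?_
  have hodd : Odd i := (Finset.mem_filter.1 hi).2
  have hi0 : (i : ℚ_[2]) ≠ 0 := by
    rintro h
    rw [Nat.cast_eq_zero] at h
    subst h
    simp at hodd
  have hunit : PadicDvd 0 ((i : ℚ_[2]) ^ k) := by
    have h1 : ‖(i : ℚ_[2])‖ = 1 := by
      simpa [PadicExact] using padicExact_zero_of_odd hodd
    simp [PadicDvd, norm_zpow, h1]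
  have hpow : PadicDvd N ((i : ℚ_[2]) ^ (2 ^ N) - 1) := by
    have h1 := Nat.ModEq.pow_totient ((Nat.coprime_two_right.2 hodd).pow_right (N + 1))
    rw [Nat.totient_prime_pow_succ Nat.prime_two] at h1
    simp only [Nat.add_one_sub_one, mul_one] at h1
    have hge : 1 ≤ i ^ 2 ^ N := Nat.one_le_pow _ _ hodd.pos
    have h2 := (Nat.modEq_iff_dvd' hge).1 h1.symm
    have h3 := padicDvd_natCast_of_dvd ((pow_dvd_pow 2 (Nat.le_succ N)).trans h2)
    rw [Nat.cast_sub hge] at h3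
    exact_mod_cast h3
  have h := (padicDvd_zero_natCast (n.choose i)).mul (hunit.mul hpow)
  rw [zero_add, zero_add] at h
  convert h using 1
  rw [zpow_add₀ hi0]
  have : (i : ℚ_[2]) ^ ((2 : ℤ) ^ N) = (i : ℚ_[2]) ^ (2 ^ N) := by
    rw [← zpow_natCast]; push_cast; rfl
  rw [this]
  ring

theorem partialStirling_zero_right (n : ℕ) : partialStirling (n + 1) 0 = 2 ^ n := by
  have := partialStirling_natCast n 0 1 (by norm_num)
  simpa [newtonWeight] using this

section

variable {n c E p₀ : ℕ}

theorem IsDominantIndex.exact_sub_of_pos (H : IsDominantIndex n c E p₀) (y : ℤ) {δ : ℕ}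
    (hδ : δ ≠ 0) :
    PadicExact ((n : ℤ) + c - E + padicValNat 2 δ)
      (((partialStirling (n + 1) (2 ^ c * (y + δ)) : ℚ) : ℚ_[2]) -
        ((partialStirling (n + 1) (2 ^ c * y) : ℚ) : ℚ_[2])) := by
  -- N is large enough that the shift by 2^N errs beyond the valuation sought and that y + 2^(N-c)
  -- is nonnegative.
  obtain ⟨N, hN⟩ : ∃ N : ℕ, N = c + (n + c + padicValNat 2 δ + 1) + y.natAbs := ⟨_, rfl⟩
  have hy : 0 ≤ y + 2 ^ (N - c) := by
    have h1 : y.natAbs < 2 ^ y.natAbs := Nat.lt_two_pow_self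
    have h2 : 2 ^ y.natAbs ≤ 2 ^ (N - c) := Nat.pow_le_pow_right (by norm_num) (by omega)
    have h3 : (y.natAbs : ℤ) < 2 ^ (N - c) := by exact_mod_cast h1.trans_le h2
    omega
  obtain ⟨q, hq⟩ := Int.eq_ofNat_of_zero_le hy
  have hk : 2 ^ c * y + 2 ^ N = ((2 ^ c * q : ℕ) : ℤ) := by
    push_cast
    rw [← hq, mul_add, ← pow_add, Nat.add_sub_cancel' (by omega)]
  have hkd : 2 ^ c * (y + δ) + 2 ^ N = ((2 ^ c * q + 2 ^ c * δ : ℕ) : ℤ) := by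
    rw [Nat.cast_add, ← hk]; push_cast; ring
  have h1 := H.exact_add_sub (Dvd.intro q rfl : 2 ^ c ∣ 2 ^ c * q) (d := 2 ^ c * δ)
    (by positivity) (Dvd.intro δ rfl)
  rw [padicValNat.mul (by positivity) hδ, padicValNat.prime_pow, ← hk, ← hkd] at h1
  have h2 := padicDvd_partialStirling_add_two_pow_sub (n + 1) N (2 ^ c * y)
  have h3 := padicDvd_partialStirling_add_two_pow_sub (n + 1) N (2 ^ c * (y + δ))
  have h4 : PadicDvd N (-(((partialStirling (n + 1) (2 ^ c * (y + δ) + 2 ^ N) : ℚ) : ℚ_[2]) -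
      ((partialStirling (n + 1) (2 ^ c * (y + δ)) : ℚ) : ℚ_[2]))) := by
    unfold PadicDvd at *; rwa [norm_neg]
  have h5 := h1.add_dvd ((h2.add h4).mono (by omega))
  convert h5 using 1
  · push_cast; ring
  · ring

theorem IsDominantIndex.norm_sub (H : IsDominantIndex n c E p₀) (x y : ℤ) :
    ‖((partialStirling (n + 1) (2 ^ c * x) : ℚ) : ℚ_[2]) -
        ((partialStirling (n + 1) (2 ^ c * y) : ℚ) : ℚ_[2])‖ =
      ‖((x - y : ℤ) : ℚ_[2])‖ * (2 : ℝ) ^ (-((n : ℤ) + c - E)) := by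
  wlog hxy : y ≤ x generalizing x y
  · rw [norm_sub_rev, this y x (by omega), ← neg_sub x y, Int.cast_neg, norm_neg]
  obtain ⟨δ, rfl⟩ := Int.le.dest hxy
  rcases eq_or_ne δ 0 with rfl | hδ
  · simp
  · have h1 := H.exact_sub_of_pos y hδ
    have h2 := padicExact_natCast hδ
    unfold PadicExact at h1 h2
    rw [h1, add_sub_cancel_left, Int.cast_natCast, h2, ← zpow_add₀ (by norm_num)]
    congr 1
    ring

theorem IsDominantIndex.exists_zero (H : IsDominantIndex n c E p₀) (hcE : c ≤ E) :
    ∃ xbar : ℤ_[2], ∀ x : ℤ, ‖((partialStirling (n + 1) (2 ^ c * x) : ℚ) : ℚ_[2])‖ =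
      ‖(x : ℚ_[2]) - (xbar : ℚ_[2])‖ * (2 : ℝ) ^ (-((n : ℤ) + c - E)) := by
  set t : ℤ := (n : ℤ) + c - E with ht
  have h2 : ‖(2 : ℚ_[2]) ^ t‖ = (2 : ℝ) ^ (-t) := by
    have := Padic.norm_p_zpow (p := 2) t
    exact_mod_cast this
  have hpos : (0 : ℝ) < (2 : ℝ) ^ (-t) := by positivity
  obtain ⟨xbar, hx⟩ := exists_zero_of_isometry
    (g := fun x => ((partialStirling (n + 1) (2 ^ c * x) : ℚ) : ℚ_[2]) / 2 ^ t) (by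
      rw [mul_zero, partialStirling_zero_right, norm_div, h2, div_le_one hpos]
      push_cast
      exact ((padicExact_two_pow n).dvd.mono (by omega : t ≤ n))) (by
      intro x y
      rw [← sub_div, norm_div, h2, H.norm_sub, mul_div_assoc, div_self hpos.ne', mul_one])
  refine ⟨xbar, fun x => ?_⟩
  rw [← hx x, norm_div, h2, div_mul_cancel₀ _ hpos.ne']

end

theorem nu_eq_add_of_norm_eq {z w : ℚ_[2]} {t : ℤ} (h : ‖z‖ = ‖w‖ * (2 : ℝ) ^ (-t)) :
    nu z = nu w + (t : WithTop ℤ) := by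
  unfold nu
  rcases eq_or_ne w 0 with rfl | hw
  · rw [norm_zero, zero_mul, norm_eq_zero] at h
    rw [h]
    simp
  · have hz : z ≠ 0 := by
      rw [← norm_pos_iff, h]
      exact mul_pos (norm_pos_iff.2 hw) (by positivity)
    rw [Padic.addValuation.apply hz, Padic.addValuation.apply hw, ← WithTop.coe_add]
    rw [Padic.norm_eq_zpow_neg_valuation hz, Padic.norm_eq_zpow_neg_valuation hw] at h
    push_cast at h
    rw [← zpow_add₀ (by norm_num)] at h
    have := zpow_right_injective₀ (by norm_num : (0 : ℝ) < 2) (by norm_num) h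
    congr 1
    linarith

theorem exists_isDominantIndex_of_two_pow_lt {n e : ℕ} (hn : 5 ≤ n) (h1 : 2 ^ e < n)
    (h2 : n ≤ 3 * 2 ^ (e - 1)) : 1 ≤ e ∧ ∃ p₀, IsDominantIndex (n - 1) (e - 1) e p₀ := by
  obtain ⟨e, rfl⟩ : ∃ f, e = f + 2 := by
    refine ⟨e - 2, ?_⟩
    by_contra hcon
    have : e = 0 ∨ e = 1 := by omega
    rcases this with rfl | rfl <;> simp at h2 <;> omega
  have e1 : 2 ^ (e + 2 - 1) = 2 * 2 ^ e := by rw [← pow_succ']; congr 1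
  have e2 : 2 ^ (e + 2) = 4 * 2 ^ e := by ring
  have e3 : 2 ^ (e + 2 + 1) = 8 * 2 ^ e := by ring
  have e4 : 2 ^ (e + 2 - 1 + 1) = 4 * 2 ^ e := by rw [← e2]; congr 1
  rw [e1] at h2
  rw [e2] at h1
  -- Taking i one below the exponent of 2^e makes p₀ = 2^(e-1) = 2^c.
  refine ⟨by omega, _, isDominantIndex_of_mem_dyadic (i := e + 2 - 1) (by omega) (fun p hp => ?_)
    (by omega) (by omega) ?_ ?_ ?_⟩ <;> omega

theorem exists_isDominantIndex_of_lt {n e : ℕ} (hn : 5 ≤ n) (h1 : 3 * 2 ^ (e - 1) < n)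
    (h2 : n ≤ 2 ^ (e + 1) - 2) : ∃ p₀, IsDominantIndex (n - 1) e e p₀ := by
  have he : 1 ≤ e := by
    by_contra hcon
    obtain rfl : e = 0 := by omega
    simp at h2; omega
  obtain ⟨f, rfl⟩ : ∃ f, e = f + 1 := ⟨e - 1, by omega⟩
  rw [Nat.add_sub_cancel] at h1
  have e1 : 2 ^ (f + 1) = 2 * 2 ^ f := by ring
  have e2 : 2 ^ (f + 1 + 1) = 4 * 2 ^ f := by ring
  have hpos := Nat.one_le_two_pow (n := f)
  -- The dyadic block is read off the leading bit i of M. The upper bound on n gives M ≥ 2, so i ≥ 1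
  -- and p₀ is even; M = 1 is the excluded form 2^m - 1.
  set M := 2 ^ (f + 1 + 1) - n with hM
  have hM0 : M ≠ 0 := by omega
  have hlog := Nat.lt_pow_succ_log_self (b := 2) (by norm_num) M
  have hlog' := Nat.pow_log_le_self 2 hM0
  have hi : Nat.log 2 M < f + 1 := by
    refine (Nat.pow_lt_pow_iff_right (by norm_num : 1 < 2)).1 (lt_of_le_of_lt hlog' ?_)
    omega
  refine ⟨_, isDominantIndex_of_mem_dyadic (i := Nat.log 2 M) he (fun p hp => by omega)
    (Nat.log_pos (by norm_num) (by omega)) hi ?_ ?_ (Nat.sub_le _ _)⟩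
  · rw [Nat.succ_eq_add_one] at hlog; omega
  · omega

theorem theorem1p3 (n e : ℕ) (a b : ℤ) (hn : 5 ≤ n)
    (hab : (n = 2 ^ e ∧ a = -2 ∧ b = 1) ∨
      (2 ^ e < n ∧ n ≤ 3 * 2 ^ (e - 1) ∧ a = -1 ∧ b = 2) ∨
      (3 * 2 ^ (e - 1) < n ∧ n ≤ 2 ^ (e + 1) - 2 ∧ a = 0 ∧ b = 1)) :
    ∃ xbar : ℤ_[2], ∀ x : ℤ,
      nu ((partialStirling n (2 ^ ((e : ℤ) + a).toNat * x) : ℚ) : ℚ_[2]) =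
        nu ((x : ℚ_[2]) - (xbar : ℚ_[2])) + (((n : ℤ) - b : ℤ) : WithTop ℤ) := by
  -- In all three cases e + a ≥ 0, so `toNat` changes nothing; E = c + b - 1 turns (n-1) + c - E
  -- into n - b.
  suffices H : ∃ c E p₀ : ℕ, ((e : ℤ) + a).toNat = c ∧ (E : ℤ) = c + b - 1 ∧ c ≤ E ∧
      IsDominantIndex (n - 1) c E p₀ by
    obtain ⟨c, E, p₀, hc, hE, hcE, H⟩ := H
    obtain ⟨xbar, hx⟩ := H.exists_zero hcE
    refine ⟨xbar, fun x => nu_eq_add_of_norm_eq ?_⟩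
    have h := hx x
    rw [Nat.sub_add_cancel (by omega : 1 ≤ n)] at h
    rw [hc, h]
    congr 3
    omega
  rcases hab with ⟨hne, rfl, rfl⟩ | ⟨h1, h2, rfl, rfl⟩ | ⟨h1, h2, rfl, rfl⟩
  · obtain ⟨c, rfl⟩ : ∃ c, e = c + 2 := by
      refine ⟨e - 2, ?_⟩
      by_contra hcon
      have : e = 0 ∨ e = 1 := by omega
      rcases this with rfl | rfl <;> simp at hne <;> omega
    have hc : 1 ≤ c := by
      by_contra hcon
      obtain rfl : c = 0 := by omega
      simp at hne; omega
    subst hne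
    exact ⟨c, c, 2 ^ c, by omega, by omega, le_rfl, isDominantIndex_two_pow_sub_one hc⟩
  · obtain ⟨he, p₀, H⟩ := exists_isDominantIndex_of_two_pow_lt hn h1 h2
    exact ⟨e - 1, e, p₀, by omega, by omega, by omega, H⟩
  · obtain ⟨p₀, H⟩ := exists_isDominantIndex_of_lt hn h1 h2
    exact ⟨e, e, p₀, by omega, by omega, le_rfl, H⟩
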